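/- Let $d\in\mathbb N$ and let $\{X_{nj}: n\in\mathbb N,\ j\in\mathbb Z^d\}$ be real random variables with mean zero on a probability space $(\Omega,\mathcal F,P)$ such that, for each $n$, the variables $X_{nj}$, $j\in\mathbb Z^d$, are independent. Assume that for each $n$ there is $H_n>0$ such that, for every $j$, $\mathbb E e^{zX_{nj}}$ exists for all complex $z$ with $|z|<H_n$ and has there an analytic logarithm $L_{nj}(z)=\log \mathbb E e^{zX_{nj}}$, normalized by $L_{nj}(0)=0$. Let $S_n=\sum_{j\in\mathbb Z^d}X_{nj}$, which is assumed to be well defined as the limit in probability, as $m\to\infty$, of the sums of $X_{nj}$ over $j\in[-m,m]^d\cap\mathbb Z^d$. Put $B_n=\sum_{j\in\mathbb Z^d}\operatorname{Var}(X_{nj})$, assumed finite for each $n$, and $F_n(x)=P(S_n<x\sqrt{B_n})$. Suppose that there are constants $c_{nj}\ge 0$ with $|L_{nj}(z)|\le c_{nj}$ for all $|z|<H_n$, all $n\in\mathbb N$ and all $j\in\mathbb Z^d$, that $B_nH_n^2\to\infty$ as $n\to\infty$, and that $C_n:=\sum_{j\in\mathbb Z^d}c_{nj}$ is finite for each $n$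 with $C_n=O(B_nH_n^2)$ as $n\to\infty$. Then for every real sequence $x=x_n$ with $x_n\to\infty$ and $x_n=o(H_n\sqrt{B_n})$ as $n\to\infty$, and for every constant $c>0$, $$\frac{F_n\left(x_n+\frac{c}{x_n}\right)-F_n(x_n)}{1-F_n(x_n)}\longrightarrow 1-e^{-c}\qquad(n\to\infty).$$ -/

import Mathlib

open MeasureTheory ProbabilityTheory Filter Topology Asymptotics

namespace CramerField

noncomputable section

variable {Ω : Type*} [MeasurableSpace Ω] {d : ℕ}

/-- `L` is the cumulant generating function of `Y` on the complex disc `{|z| < r}`: the complex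
moment generating function `E exp (z Y)` exists there, and `L` is the analytic branch of its
logarithm with `L 0 = 0`. -/
structure IsCGFOnDisc (Y : Ω → ℝ) (μ : Measure Ω) (r : ℝ) (L : ℂ → ℂ) : Prop where
  integrable : ∀ z : ℂ, ‖z‖ < r → Integrable (fun ω => Complex.exp (z * (Y ω : ℂ))) μ
  analytic : AnalyticOnNhd ℂ L (Metric.ball 0 r)
  map_zero : L 0 = 0
  exp_eq : ∀ z : ℂ, ‖z‖ < r → Complex.exp (L z) = complexMGF Y μ z

/-- The cube `[-m, m]^d ∩ ℤ^d`. -/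
def cube (d m : ℕ) : Finset (Fin d → ℤ) :=
  Finset.Icc (fun _ => -(m : ℤ)) (fun _ => (m : ℤ))

/-- The sum of the field `Y` over the cube `[-m, m]^d ∩ ℤ^d`. -/
def cubeSum (Y : (Fin d → ℤ) → Ω → ℝ) (m : ℕ) (ω : Ω) : ℝ :=
  ∑ j ∈ cube d m, Y j ω

/-- `T` is the sum over all of `ℤ^d` of the field `Y`: the limit of the sums over cubes,
in probability. -/
def IsFieldSum (Y : (Fin d → ℤ) → Ω → ℝ) (μ : Measure Ω) (T : Ω → ℝ) : Prop :=
  TendstoInMeasure μ (cubeSum Y) atTop T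

/-- The sum over `ℤ^d` of the variances of the field `Y`. -/
def totalVar (Y : (Fin d → ℤ) → Ω → ℝ) (μ : Measure Ω) : ℝ :=
  ∑' j, Var[Y j; μ]

/-- The left-continuous distribution function `x ↦ P (T < x √b)`. -/
def normCDF (T : Ω → ℝ) (μ : Measure Ω) (b x : ℝ) : ℝ :=
  μ.real {ω | T ω < x * √b}

end

end CramerField

/-!
Cramér's method of conjugate distributions. The independence of the summands and the bounds `c n j`
make `∑ j, L n j` the logarithm of the moment generating function of `S n` on the disc of radius
`H n`. After normalising by `√(B n)`, Cauchy's estimates show that it differs from `z ^ 2 / 2` by at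
most `C * ‖z‖ ^ 3`, where `C * x n → 0`. Hence its derivative takes the value `x` at a real point
`h ∼ x`, the saddle point. Tilting by `exp (h W)` and putting `Y = h (W - x)`, one obtains
`P (W ≥ x + b) = exp (-h x) * E exp (h W) * E' (exp (-Y); Y ≥ h b)`, so that the ratio of the tails
at `x + a / x` and `x` is a ratio of truncated exponential moments of `Y`.

Under the tilted law, `Y` is close to a centred normal variable of standard deviation `h → ∞`, in
the sense that the characteristic functions agree up to a factor `exp (o((h s) ^ 2))` on bounded
sets of frequencies. This is enough for a local limit theorem: `h` times the law of `Y` converges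
to `(2π)^(-1/2)` times Lebesgue measure. It is tested first against a kernel with compactly
supported Fourier transform and decay `(1 + y ^ 2)⁻¹`, where Fourier inversion and dominated
convergence apply, and then, by Lévy's continuity theorem for the measures weighted by the kernel,
against all continuous functions dominated by the kernel. The truncated exponential moments are
squeezed between such functions, and their ratio tends to `exp (-a)`.
-/

namespace CramerField

section CauchyEstimates

variable {E : Type*} [NormedAddCommGroup E] [NormedSpace ℂ E] [CompleteSpace E] {f : ℂ → E}
  {c z : ℂ} {r M : ℝ}

lemma norm_iteratedDeriv_le_of_forall_mem_ball (hr : 0 < r)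
    (hf : DifferentiableOn ℂ f (Metric.ball c r)) (hM : ∀ z ∈ Metric.ball c r, ‖f z‖ ≤ M) (k : ℕ) :
    ‖iteratedDeriv k f c‖ ≤ k.factorial * M / r ^ k := by
  have hlim : Tendsto (fun s : ℝ => k.factorial * M / s ^ k) (𝓝[<] r)
      (𝓝 (k.factorial * M / r ^ k)) :=
    (tendsto_const_nhds.div ((continuous_pow k).tendsto r) (by positivity)).mono_left
      nhdsWithin_le_nhds
  refine ge_of_tendsto hlim ?_
  filter_upwards [self_mem_nhdsWithin, mem_nhdsWithin_of_mem_nhds (lt_mem_nhds hr)] with s hs h0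
  have hsub : Metric.closedBall c s ⊆ Metric.ball c r := Metric.closedBall_subset_ball hs
  refine Complex.norm_iteratedDeriv_le_of_forall_mem_sphere_norm_le k h0
    (DifferentiableOn.diffContOnCl ?_) fun z hz => hM z (hsub (Metric.sphere_subset_closedBall hz))
  rw [closure_ball c h0.ne']
  exact hf.mono hsub

lemma norm_sub_taylor_le (hr : 0 < r) (hf : DifferentiableOn ℂ f (Metric.ball c r))
    (hM : ∀ z ∈ Metric.ball c r, ‖f z‖ ≤ M) (k : ℕ) (hz : ‖z - c‖ ≤ r / 2) :
    ‖f z - ∑ i ∈ Finset.range k, (i.factorial : ℂ)⁻¹ • (z - c) ^ i • iteratedDeriv i f c‖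
      ≤ 2 * M * (‖z - c‖ / r) ^ k := by
  have hM0 : 0 ≤ M := (norm_nonneg _).trans (hM c (Metric.mem_ball_self hr))
  have hzr : z ∈ Metric.ball c r := by rw [mem_ball_iff_norm]; linarith
  set q := ‖z - c‖ / r with hq
  have hq0 : 0 ≤ q := by positivity
  have hq1 : q ≤ 1 / 2 := by rw [hq, div_le_iff₀ hr]; linarith
  have hgeom : HasSum (fun i : ℕ => M * q ^ k * q ^ i) (M * q ^ k * (1 - q)⁻¹) :=
    (hasSum_geometric_of_lt_one hq0 (by linarith)).mul_left _
  have hterm (i : ℕ) :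
      ‖((i + k).factorial : ℂ)⁻¹ • (z - c) ^ (i + k) • iteratedDeriv (i + k) f c‖
        ≤ M * q ^ k * q ^ i := by
    rw [norm_smul, norm_smul, norm_inv, norm_pow, norm_natCast]
    calc _ ≤ ((i + k).factorial : ℝ)⁻¹ * (‖z - c‖ ^ (i + k)
          * ((i + k).factorial * M / r ^ (i + k))) := by
          gcongr
          exact norm_iteratedDeriv_le_of_forall_mem_ball hr hf hM (i + k)
      _ = M * q ^ k * q ^ i := by
          rw [hq, div_pow, div_pow, pow_add, pow_add]
          field_simp
  have htail := (hasSum_nat_add_iff' k).2 (Complex.hasSum_taylorSeries_on_ball hf hzr)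
  have hinv : (1 - q)⁻¹ ≤ 2 := by
    rw [inv_le_comm₀ (by linarith) two_pos]
    linarith
  calc _ ≤ M * q ^ k * (1 - q)⁻¹ := htail.norm_le_of_bounded hgeom hterm
    _ ≤ M * q ^ k * 2 := by gcongr
    _ = _ := by ring

end CauchyEstimates

section PowerBound

lemma nonneg_of_norm_le_pow {E : Type*} [SeminormedAddGroup E] {R : ℂ → E} {C D : ℝ} {k : ℕ}
    (hD : 0 < D) (hC : ∀ z, ‖z‖ < D → ‖R z‖ ≤ C * ‖z‖ ^ k) : 0 ≤ C := by
  have hnorm : ‖((D / 2 : ℝ) : ℂ)‖ = D / 2 := by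
    rw [Complex.norm_real, Real.norm_of_nonneg (by positivity)]
  have hle := (norm_nonneg _).trans (hC (D / 2 : ℝ) (by linarith))
  exact nonneg_of_mul_nonneg_left hle (by rw [hnorm]; positivity)

variable {E : Type*} [NormedAddCommGroup E] [NormedSpace ℂ E] {R : ℂ → E} {h z : ℂ}
  {C D ρ : ℝ} {k : ℕ}

lemma norm_deriv_le_of_norm_le_pow (hR : DifferentiableOn ℂ R (Metric.ball 0 D))
    (hC : ∀ z, ‖z‖ < D → ‖R z‖ ≤ C * ‖z‖ ^ k) (hρ : 0 < ρ) (hρD : 2 * ρ < D)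
    (hz : ‖z‖ ≤ ρ) : ‖deriv R z‖ ≤ C * (2 * ρ) ^ k / ρ := by
  have hC0 : 0 ≤ C := nonneg_of_norm_le_pow (by linarith) hC
  have hnorm : ∀ w ∈ Metric.closedBall z ρ, ‖w‖ ≤ 2 * ρ := fun w hw => by
    linarith [norm_le_norm_add_norm_sub z w, mem_closedBall_iff_norm'.1 hw]
  refine Complex.norm_deriv_le_of_forall_mem_sphere_norm_le hρ
    (DifferentiableOn.diffContOnCl ?_) fun w hw => ?_
  · rw [closure_ball z hρ.ne']
    exact hR.mono fun w hw => mem_ball_zero_iff.2 ((hnorm w hw).trans_lt hρD)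
  · have hw' := hnorm w (Metric.sphere_subset_closedBall hw)
    exact (hC w (hw'.trans_lt hρD)).trans (by gcongr)

lemma norm_add_sub_sub_smul_deriv_le_of_norm_le_pow [CompleteSpace E]
    (hR : DifferentiableOn ℂ R (Metric.ball 0 D))
    (hC : ∀ z, ‖z‖ < D → ‖R z‖ ≤ C * ‖z‖ ^ k) (hρ : 0 < ρ) (hρD : 3 * ρ < D)
    (hh : ‖h‖ ≤ ρ) (hz : ‖z‖ ≤ ρ) :
    ‖R (h + z) - R h - z • deriv R h‖ ≤ 2 * (C * (3 * ρ) ^ k) * (‖z‖ / (2 * ρ)) ^ 2 := by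
  have hC0 : 0 ≤ C := nonneg_of_norm_le_pow (by linarith) hC
  have hnorm : ∀ w ∈ Metric.ball h (2 * ρ), ‖w‖ < 3 * ρ := fun w hw => by
    linarith [norm_le_norm_add_norm_sub h w, mem_ball_iff_norm'.1 hw]
  have htaylor := norm_sub_taylor_le (f := R) (c := h) (z := h + z) (M := C * (3 * ρ) ^ k)
    (by positivity) (hR.mono fun w hw => mem_ball_zero_iff.2 ((hnorm w hw).trans hρD))
    (fun w hw => (hC w ((hnorm w hw).trans hρD)).trans (by have := (hnorm w hw).le; gcongr)) 2
    (by simpa using hz)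
  simpa [Finset.sum_range_succ, sub_add_eq_sub_sub] using htaylor

end PowerBound

namespace IsCGFOnDisc

variable {Ω : Type*} [MeasurableSpace Ω] {μ : Measure Ω} {Y Z T : Ω → ℝ} {r u C : ℝ} {L K : ℂ → ℂ}

lemma differentiableOn (hL : IsCGFOnDisc Y μ r L) : DifferentiableOn ℂ L (Metric.ball 0 r) :=
  hL.analytic.differentiableOn

lemma mem_integrableExpSet (hL : IsCGFOnDisc Y μ r L) (hu : |u| < r) :
    u ∈ integrableExpSet Y μ := by
  have := (hL.integrable u (by simpa using hu)).norm
  simpa [Complex.norm_exp, integrableExpSet] using this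

lemma mem_interior_integrableExpSet (hL : IsCGFOnDisc Y μ r L) (hu : |u| < r) :
    u ∈ interior (integrableExpSet Y μ) :=
  mem_interior.2 ⟨Set.Ioo (-r) r, fun _ hv => hL.mem_integrableExpSet (abs_lt.2 hv), isOpen_Ioo,
    abs_lt.1 hu⟩

lemma aemeasurable (hL : IsCGFOnDisc Y μ r L) (hr : 0 < r) : AEMeasurable Y μ :=
  aemeasurable_of_mem_interior_integrableExpSet
    (hL.mem_interior_integrableExpSet (u := 0) (by simpa using hr))

lemma deriv_ofReal (hL : IsCGFOnDisc Y μ r L) (hu : |u| < r) :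
    deriv L u = ((deriv (cgf Y μ) u : ℝ) : ℂ) := by
  have hmem : (u : ℂ) ∈ Metric.ball (0 : ℂ) r := by simpa using hu
  have hexp : (fun z => Complex.exp (L z)) =ᶠ[𝓝 (u : ℂ)] complexMGF Y μ := by
    filter_upwards [Metric.isOpen_ball.mem_nhds hmem] with z hz
    exact hL.exp_eq z (by simpa using hz)
  have hderiv := (hL.analytic u hmem).differentiableAt.hasDerivAt.cexp.unique
    ((hasDerivAt_complexMGF
      (by simpa using hL.mem_interior_integrableExpSet hu)).congr_of_eventuallyEq hexp)
  have hmgf : Complex.exp (L u) = (mgf Y μ u : ℂ) := by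
    rw [hL.exp_eq u (by simpa using hu), complexMGF_ofReal]
  have hreal : ∫ ω, (Y ω : ℂ) * Complex.exp (u * Y ω) ∂μ
      = ((∫ ω, Y ω * Real.exp (u * Y ω) ∂μ : ℝ) : ℂ) := by
    rw [← integral_complex_ofReal]
    push_cast
    rfl
  rw [deriv_cgf (hL.mem_interior_integrableExpSet hu), Complex.ofReal_div, ← hreal, ← hmgf,
    ← hderiv, mul_div_cancel_left₀ _ (Complex.exp_ne_zero _)]

lemma iteratedDeriv_two_ofReal (hL : IsCGFOnDisc Y μ r L) (hu : |u| < r) :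
    iteratedDeriv 2 L u = ((iteratedDeriv 2 (cgf Y μ) u : ℝ) : ℂ) := by
  simp only [iteratedDeriv_succ, iteratedDeriv_zero]
  have hcgf := (analyticAt_cgf (hL.mem_interior_integrableExpSet hu)).deriv.differentiableAt
  have hanalytic := (hL.analytic u (by simpa using hu)).deriv.differentiableAt
  refine hanalytic.hasDerivAt.comp_ofReal.unique
    (hcgf.hasDerivAt.ofReal_comp.congr_of_eventuallyEq ?_)
  filter_upwards [continuous_abs.continuousAt.eventually_lt continuousAt_const hu] with v hv
  exact hL.deriv_ofReal hv

lemma deriv_zero [IsProbabilityMeasure μ] (hL : IsCGFOnDisc Y μ r L) (hr : 0 < r) :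
    deriv L 0 = (μ[Y] : ℝ) := by
  have h0 : |(0 : ℝ)| < r := by simpa using hr
  simpa [deriv_cgf_zero (hL.mem_interior_integrableExpSet h0)] using hL.deriv_ofReal h0

lemma iteratedDeriv_two_zero [IsProbabilityMeasure μ] (hL : IsCGFOnDisc Y μ r L) (hr : 0 < r) :
    iteratedDeriv 2 L 0 = Var[Y; μ] := by
  have h0 : |(0 : ℝ)| < r := by simpa using hr
  have hvar := variance_tilted_mul (hL.mem_interior_integrableExpSet h0)
  simp only [zero_mul, tilted_const] at hvar
  simpa [hvar] using hL.iteratedDeriv_two_ofReal h0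

lemma norm_sub_variance_mul_le [IsProbabilityMeasure μ] (hL : IsCGFOnDisc Y μ r L) (hr : 0 < r)
    (hmean : μ[Y] = 0) (hC : ∀ z : ℂ, ‖z‖ < r → ‖L z‖ ≤ C) {z : ℂ} (hz : ‖z‖ ≤ r / 2) :
    ‖L z - Var[Y; μ] * z ^ 2 / 2‖ ≤ 2 * C * (‖z‖ / r) ^ 3 := by
  have hpoly : ∑ i ∈ Finset.range 3, (i.factorial : ℂ)⁻¹ • (z - 0) ^ i • iteratedDeriv i L 0
      = Var[Y; μ] * z ^ 2 / 2 := by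
    simp [Finset.sum_range_succ, hL.map_zero, hL.deriv_zero hr, hmean,
      hL.iteratedDeriv_two_zero hr, div_eq_inv_mul, mul_comm (z ^ 2)]
  have htaylor := norm_sub_taylor_le hr hL.differentiableOn
    (fun w hw => hC w (by simpa using hw)) 3 (z := z) (by simpa using hz)
  rwa [hpoly, sub_zero] at htaylor

lemma mgf_eq_exp_re (hL : IsCGFOnDisc Y μ r L) (hu : |u| < r) :
    mgf Y μ u = Real.exp (L u).re := by
  have h := congrArg norm (hL.exp_eq u (by simpa using hu))
  rw [complexMGF_ofReal, Complex.norm_exp, Complex.norm_real, Real.norm_of_nonneg mgf_nonneg] at h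
  exact h.symm

lemma zero [IsProbabilityMeasure μ] : IsCGFOnDisc (0 : Ω → ℝ) μ r 0 where
  integrable z _ := by simp
  analytic := analyticOnNhd_const
  map_zero := rfl
  exp_eq z _ := by simp [complexMGF]

lemma add (hL : IsCGFOnDisc Y μ r L) (hK : IsCGFOnDisc Z μ r K) (hind : IndepFun Y Z μ) :
    IsCGFOnDisc (Y + Z) μ r (L + K) := by
  have hexp (z : ℂ) : (fun ω => Complex.exp (z * ((Y + Z) ω : ℝ)))
      = (fun ω => Complex.exp (z * Y ω)) * fun ω => Complex.exp (z * Z ω) := by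
    ext ω
    simp [mul_add, Complex.exp_add]
  have hind' (z : ℂ) :
      IndepFun (fun ω => Complex.exp (z * Y ω)) (fun ω => Complex.exp (z * Z ω)) μ :=
    hind.comp (φ := fun y : ℝ => Complex.exp (z * y)) (ψ := fun y : ℝ => Complex.exp (z * y))
      (by fun_prop) (by fun_prop)
  refine ⟨fun z hz => ?_, hL.analytic.add hK.analytic, by simp [hL.map_zero, hK.map_zero],
    fun z hz => ?_⟩
  · rw [hexp]
    exact (hind' z).integrable_mul (hL.integrable z hz) (hK.integrable z hz)
  · rw [Pi.add_apply, Complex.exp_add, hL.exp_eq z hz, hK.exp_eq z hz]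
    simp only [complexMGF]
    rw [hexp]
    exact ((hind' z).integral_mul_eq_mul_integral (hL.integrable z hz).aestronglyMeasurable
      (hK.integrable z hz).aestronglyMeasurable).symm

lemma sum {ι : Type*} {Y : ι → Ω → ℝ} {L : ι → ℂ → ℂ} (hr : 0 < r)
    (hL : ∀ j, IsCGFOnDisc (Y j) μ r (L j)) (hind : iIndepFun Y μ) (s : Finset ι) :
    IsCGFOnDisc (∑ j ∈ s, Y j) μ r (∑ j ∈ s, L j) := by
  classical
  have := hind.isProbabilityMeasure
  induction s using Finset.induction_on with
  | empty => simpa using zero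
  | insert j s hj ih =>
    rw [Finset.sum_insert hj, Finset.sum_insert hj]
    exact (hL j).add ih
      (hind.indepFun_finsetSum_of_notMem₀ (fun i => (hL i).aemeasurable hr) hj).symm

section Limit

variable {S : ℕ → Ω → ℝ} {Λ : ℕ → ℂ → ℂ}

/-- Fatou's lemma along an almost surely convergent subsequence. -/
lemma mem_integrableExpSet_of_tendstoInMeasure (hr : 0 < r)
    (hΛ : ∀ m, IsCGFOnDisc (S m) μ r (Λ m)) (hC : ∀ m, ∀ z : ℂ, ‖z‖ < r → ‖Λ m z‖ ≤ C)
    (hT : TendstoInMeasure μ S atTop T) (hu : |u| < r) : u ∈ integrableExpSet T μ := by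
  obtain ⟨ns, -, hns⟩ := hT.exists_seq_tendsto_ae
  have hmeas (m : ℕ) : AEMeasurable (S m) μ := (hΛ m).aemeasurable hr
  have hTmeas : AEMeasurable T μ := hT.aemeasurable hmeas
  have hbound (m : ℕ) : eLpNorm (fun ω => Real.exp (u * S m ω)) 1 μ
      ≤ ENNReal.ofReal (Real.exp C) := by
    have hint : Integrable (fun ω => Real.exp (u * S m ω)) μ := (hΛ m).mem_integrableExpSet hu
    rw [eLpNorm_one_eq_lintegral_enorm, ← ofReal_integral_norm_eq_lintegral_enorm hint]
    simp only [Real.norm_eq_abs, Real.abs_exp]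
    change ENNReal.ofReal (mgf (S m) μ u) ≤ _
    rw [(hΛ m).mgf_eq_exp_re hu]
    gcongr
    exact (Complex.re_le_norm _).trans (hC m u (by simpa using hu))
  have hlim : ∀ᵐ ω ∂μ, Tendsto (fun i => Real.exp (u * S (ns i) ω)) atTop
      (𝓝 (Real.exp (u * T ω))) := by
    filter_upwards [hns] with ω hω
    exact (Real.continuous_exp.tendsto _).comp (hω.const_mul u)
  refine memLp_one_iff_integrable.1 ⟨by fun_prop, ?_⟩
  exact (Lp.eLpNorm_le_of_ae_tendsto (.of_forall fun i => hbound (ns i))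
    (fun i => by have := hmeas (ns i); fun_prop) hlim).trans_lt ENNReal.ofReal_lt_top

lemma complexMGF_mul_I_of_tendstoInMeasure [IsProbabilityMeasure μ] (hr : 0 < r)
    (hΛ : ∀ m, IsCGFOnDisc (S m) μ r (Λ m)) (hT : TendstoInMeasure μ S atTop T)
    (hlim : ∀ z : ℂ, ‖z‖ < r → Tendsto (fun m => Λ m z) atTop (𝓝 (L z))) {t : ℝ} (ht : |t| < r) :
    complexMGF T μ (t * Complex.I) = Complex.exp (L (t * Complex.I)) := by
  have hz : ‖(t * Complex.I : ℂ)‖ < r := by simpa using ht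
  have hmeas (m : ℕ) : AEMeasurable (S m) μ := (hΛ m).aemeasurable hr
  have hcharFun := ProbabilityMeasure.tendsto_iff_tendsto_charFun.1
    (hT.tendstoInDistribution hmeas).tendsto t
  rw [complexMGF_mul_I (hT.aemeasurable hmeas)]
  refine tendsto_nhds_unique hcharFun (((Complex.continuous_exp.tendsto _).comp
    (hlim _ hz)).congr fun m => ?_)
  exact ((hΛ m).exp_eq _ hz).trans (complexMGF_mul_I (hmeas m) t)

/-- Convergence of the characteristic functions identifies the limit on the imaginary axis, and
the identity theorem on the whole disc. -/
theorem of_tendstoInMeasure [IsProbabilityMeasure μ] (hr : 0 < r)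
    (hΛ : ∀ m, IsCGFOnDisc (S m) μ r (Λ m)) (hC : ∀ m, ∀ z : ℂ, ‖z‖ < r → ‖Λ m z‖ ≤ C)
    (hT : TendstoInMeasure μ S atTop T)
    (hlim : ∀ z : ℂ, ‖z‖ < r → Tendsto (fun m => Λ m z) atTop (𝓝 (L z)))
    (hL : DifferentiableOn ℂ L (Metric.ball 0 r)) : IsCGFOnDisc T μ r L := by
  have hexpSet {u : ℝ} (hu : |u| < r) : u ∈ integrableExpSet T μ :=
    mem_integrableExpSet_of_tendstoInMeasure hr hΛ hC hT hu
  have hre {z : ℂ} (hz : ‖z‖ < r) : |z.re| < r := (Complex.abs_re_le_norm z).trans_lt hz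
  have hmgf : AnalyticOnNhd ℂ (complexMGF T μ) (Metric.ball 0 r) := fun z hz =>
    analyticAt_complexMGF <| mem_interior.2 ⟨Set.Ioo (-r) r, fun u hu => hexpSet (abs_lt.2 hu),
      isOpen_Ioo, abs_lt.1 (hre (by simpa using hz))⟩
  have hline : Tendsto (fun t : ℝ => (t * Complex.I : ℂ)) (𝓝[>] 0) (𝓝[≠] 0) := by
    refine tendsto_nhdsWithin_iff.2 ⟨?_, ?_⟩
    · exact ((by fun_prop : Continuous fun t : ℝ => (t * Complex.I : ℂ)).tendsto' 0 0
        (by simp)).mono_left nhdsWithin_le_nhds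
    · filter_upwards [self_mem_nhdsWithin] with t (ht : 0 < t)
      simpa using ht.ne'
  have himag : ∃ᶠ z in 𝓝[≠] (0 : ℂ), complexMGF T μ z = Complex.exp (L z) := by
    refine hline.frequently (Eventually.frequently ?_)
    filter_upwards [Ioo_mem_nhdsGT hr] with t ht
    exact complexMGF_mul_I_of_tendstoInMeasure hr hΛ hT hlim (by simpa [abs_of_pos ht.1] using ht.2)
  have heq := hmgf.eqOn_of_preconnected_of_frequently_eq
    (hL.cexp.analyticOnNhd Metric.isOpen_ball) (convex_ball 0 r).isPreconnected
    (Metric.mem_ball_self hr) himag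
  refine ⟨fun z hz => ?_, hL.analyticOnNhd Metric.isOpen_ball, ?_, fun z hz =>
    (heq (mem_ball_zero_iff.2 hz)).symm⟩
  · exact integrable_cexp_mul_of_re_mem_integrableExpSet
      (hT.aemeasurable fun m => (hΛ m).aemeasurable hr) (hexpSet (hre hz))
  · exact tendsto_nhds_unique (hlim 0 (by simpa using hr)) (by simp [(hΛ _).map_zero])

end Limit

theorem tsum {ι : Type*} {Y : ι → Ω → ℝ} {L : ι → ℂ → ℂ} {c : ι → ℝ} {s : ℕ → Finset ι}
    (hr : 0 < r) (hL : ∀ j, IsCGFOnDisc (Y j) μ r (L j)) (hind : iIndepFun Y μ)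
    (hLc : ∀ j, ∀ z : ℂ, ‖z‖ < r → ‖L j z‖ ≤ c j) (hc : Summable c) (hs : Tendsto s atTop atTop)
    (hT : TendstoInMeasure μ (fun m ω => ∑ j ∈ s m, Y j ω) atTop T) :
    IsCGFOnDisc T μ r fun z => ∑' j, L j z := by
  have := hind.isProbabilityMeasure
  have hc0 (j : ι) : 0 ≤ c j := (norm_nonneg _).trans (hLc j 0 (by simpa using hr))
  refine of_tendstoInMeasure (C := ∑' j, c j) (S := fun m => ∑ j ∈ s m, Y j) hr
    (fun m => sum hr hL hind (s m)) (fun m z hz => ?_) ?_ (fun z hz => ?_) ?_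
  · rw [Finset.sum_apply]
    exact (norm_sum_le_of_le _ fun j _ => hLc j z hz).trans
      (hc.sum_le_tsum _ fun j _ => hc0 j)
  · simpa only [Finset.sum_fn] using hT
  · simp only [Finset.sum_apply]
    exact (hc.of_norm_bounded fun j => hLc j z hz).hasSum.comp hs
  · exact Complex.differentiableOn_tsum_of_summable_norm hc (fun j => (hL j).differentiableOn)
      Metric.isOpen_ball fun j z hz => hLc j z (by simpa using hz)

lemma mono {r' : ℝ} (hL : IsCGFOnDisc Y μ r L) (h : r' ≤ r) : IsCGFOnDisc Y μ r' L where
  integrable z hz := hL.integrable z (hz.trans_le h)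
  analytic := hL.analytic.mono (Metric.ball_subset_ball h)
  map_zero := hL.map_zero
  exp_eq z hz := hL.exp_eq z (hz.trans_le h)

lemma div_const {a : ℝ} (hL : IsCGFOnDisc Y μ r L) (ha : 0 ≤ a) :
    IsCGFOnDisc (fun ω => Y ω / a) μ (r * a) fun z => L (z / a) := by
  have hdisc {z : ℂ} (hz : ‖z‖ < r * a) : ‖z / a‖ < r := by
    have ha' : 0 < a := ha.lt_of_ne' fun h => by simp [h, (norm_nonneg z).not_gt] at hz
    rwa [norm_div, Complex.norm_real, Real.norm_of_nonneg ha, div_lt_iff₀ ha']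
  have hswap (z : ℂ) (ω : Ω) : z * ((Y ω / a : ℝ) : ℂ) = z / a * Y ω := by
    push_cast
    ring
  refine ⟨fun z hz => ?_, ?_, by simp [hL.map_zero], fun z hz => ?_⟩
  · simpa only [hswap] using hL.integrable _ (hdisc hz)
  · intro z hz
    exact AnalyticAt.fun_comp (f := fun z : ℂ => z / a)
      (hL.analytic _ (mem_ball_zero_iff.2 (hdisc (mem_ball_zero_iff.1 hz)))) (by fun_prop)
  · simpa only [complexMGF, hswap] using hL.exp_eq _ (hdisc hz)

end IsCGFOnDisc

lemma integrable_of_eq_zero_of_one_le {E : Type*} [NormedAddCommGroup E] {f : ℝ → E}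
    (hf : Continuous f) (h0 : ∀ s, 1 ≤ |s| → f s = 0) : Integrable f := by
  refine hf.integrable_of_hasCompactSupport
    (HasCompactSupport.intro (isCompact_closedBall (0 : ℝ) 1) fun s hs => h0 s ?_)
  simp only [mem_closedBall_zero_iff, Real.norm_eq_abs, not_le] at hs
  exact hs.le

/-- A continuous even function supported in `[-1, 1]`. The profile `sinh (1 - |s|)` is chosen
because its Fourier transform `kernel` is explicit, positive and of exact order `1 / (1 + y²)`. -/
noncomputable def window (s : ℝ) : ℝ := Real.sinh (max 0 (1 - |s|))

/-- The Fourier transform of `window`. -/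
noncomputable def kernel (y : ℝ) : ℝ := 2 * (Real.cosh 1 - Real.cos y) / (1 + y ^ 2)

@[fun_prop]
lemma continuous_window : Continuous window := by unfold window; fun_prop

lemma window_of_one_le {s : ℝ} (hs : 1 ≤ |s|) : window s = 0 := by
  rw [window, max_eq_left (by linarith), Real.sinh_zero]

lemma window_of_mem_Icc {s : ℝ} (hs : s ∈ Set.Icc 0 1) : window s = Real.sinh (1 - s) := by
  rw [window, abs_of_nonneg hs.1, max_eq_right (by linarith [hs.2])]

@[simp]
lemma window_neg (s : ℝ) : window (-s) = window s := by simp [window]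

@[fun_prop]
lemma continuous_kernel : Continuous kernel :=
  Continuous.div (by fun_prop) (by fun_prop) fun y => by positivity

lemma one_lt_cosh_one : 1 < Real.cosh 1 := Real.one_lt_cosh.2 one_ne_zero

lemma inv_one_add_sq_le_kernel (y : ℝ) :
    (1 + y ^ 2)⁻¹ ≤ (2 * (Real.cosh 1 - 1))⁻¹ * kernel y := by
  have h : 0 < Real.cosh 1 - 1 := sub_pos.2 one_lt_cosh_one
  rw [kernel, ← one_div, inv_mul_eq_div, div_right_comm]
  gcongr
  rw [one_le_div (by positivity)]
  linarith [Real.cos_le_one y]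

lemma kernel_pos (y : ℝ) : 0 < kernel y :=
  div_pos (by linarith [Real.cos_le_one y, one_lt_cosh_one]) (by positivity)

lemma kernel_le (y : ℝ) : kernel y ≤ 2 * (Real.cosh 1 + 1) * (1 + y ^ 2)⁻¹ := by
  rw [kernel, div_eq_mul_inv]
  gcongr
  linarith [Real.neg_one_le_cos y]

lemma integrable_kernel : Integrable kernel :=
  (integrable_inv_one_add_sq.const_mul _).mono' (by fun_prop) <| .of_forall fun y => by
    rw [Real.norm_of_nonneg (kernel_pos y).le]
    exact kernel_le y

lemma integral_sinh_one_sub_mul_cos (y : ℝ) :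
    ∫ s in (0 : ℝ)..1, Real.sinh (1 - s) * Real.cos (s * y) = kernel y / 2 := by
  have hy : 1 + y ^ 2 ≠ 0 := by positivity
  have hderiv (s : ℝ) : HasDerivAt (fun s => (y * (Real.sinh (1 - s) * Real.sin (s * y))
      - Real.cosh (1 - s) * Real.cos (s * y)) / (1 + y ^ 2))
      (Real.sinh (1 - s) * Real.cos (s * y)) s := by
    have hsub : HasDerivAt (fun s : ℝ => 1 - s) (-1) s := (hasDerivAt_id s).const_sub 1
    have hmul : HasDerivAt (fun s : ℝ => s * y) y s := by simpa using (hasDerivAt_id s).mul_const y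
    refine ((((hsub.sinh.mul hmul.sin).const_mul y).sub
      (hsub.cosh.mul hmul.cos)).div_const (1 + y ^ 2)).congr_deriv ?_
    field_simp
    ring
  rw [intervalIntegral.integral_eq_sub_of_hasDerivAt (fun s _ => hderiv s)
    (Continuous.intervalIntegrable (by fun_prop) _ _), kernel]
  simp
  ring

lemma integral_window_mul_cos (y : ℝ) : ∫ s, window s * Real.cos (s * y) = kernel y := by
  have hcos (s : ℝ) : Real.cos (|s| * y) = Real.cos (s * y) := by
    rcases abs_choice s with h | h <;> simp [h]
  have habs (s : ℝ) : window s * Real.cos (s * y) = window |s| * Real.cos (|s| * y) := by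
    simp only [hcos, window, abs_abs]
  have hsupp : ∫ s in Set.Ioi 0, window s * Real.cos (s * y)
      = ∫ s in Set.Ioc 0 1, window s * Real.cos (s * y) :=
    setIntegral_eq_of_subset_of_forall_sdiff_eq_zero measurableSet_Ioi Set.Ioc_subset_Ioi_self
      fun s hs => by
        have hs' : 1 < s := lt_of_not_ge fun h => hs.2 ⟨hs.1, h⟩
        rw [window_of_one_le (hs'.le.trans (le_abs_self s)), zero_mul]
  rw [integral_congr_ae (.of_forall habs),
    integral_comp_abs (f := fun s => window s * Real.cos (s * y)), hsupp,
    ← intervalIntegral.integral_of_le zero_le_one,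
    intervalIntegral.integral_congr (g := fun s => Real.sinh (1 - s) * Real.cos (s * y)),
    integral_sinh_one_sub_mul_cos, mul_div_cancel₀ _ two_ne_zero]
  intro s hs
  rw [Set.uIcc_of_le zero_le_one] at hs
  simp only [window_of_mem_Icc hs]

lemma integral_window_mul_sin (y : ℝ) : ∫ s, window s * Real.sin (s * y) = 0 := by
  have h := integral_neg_eq_self (fun s => window s * Real.sin (s * y)) volume
  simp only [window_neg, neg_mul, Real.sin_neg, mul_neg, integral_neg] at h
  linarith

lemma integral_window_mul_exp (y : ℝ) :
    ∫ s : ℝ, (window s : ℂ) * Complex.exp (s * y * Complex.I) = kernel y := by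
  have hsplit (s : ℝ) : (window s : ℂ) * Complex.exp (s * y * Complex.I)
      = ((window s * Real.cos (s * y) : ℝ) : ℂ)
        + ((window s * Real.sin (s * y) : ℝ) : ℂ) * Complex.I := by
    rw [Complex.exp_mul_I]
    push_cast
    ring
  have hcos : Integrable fun s => window s * Real.cos (s * y) :=
    integrable_of_eq_zero_of_one_le (by fun_prop) fun s hs => by simp [window_of_one_le hs]
  have hsin : Integrable fun s => window s * Real.sin (s * y) :=
    integrable_of_eq_zero_of_one_le (by fun_prop) fun s hs => by simp [window_of_one_le hs]
  simp_rw [hsplit]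
  rw [integral_add hcos.ofReal (hsin.ofReal.mul_const _), integral_mul_const,
    integral_complex_ofReal, integral_complex_ofReal, integral_window_mul_cos,
    integral_window_mul_sin, Complex.ofReal_zero, zero_mul, add_zero]

open Complex FourierTransform in
lemma integral_kernel_mul_exp (θ : ℝ) :
    ∫ y : ℝ, (kernel y : ℂ) * exp (θ * y * I) = 2 * Real.pi * window θ := by
  have hcont : Continuous fun s => (window s : ℂ) := by fun_prop
  have hint : Integrable fun s => (window s : ℂ) :=
    integrable_of_eq_zero_of_one_le hcont fun s hs => by simp [window_of_one_le hs]
  have hfourier (v : ℝ) : 𝓕 (fun s => (window s : ℂ)) v = kernel (v * (-2 * Real.pi)) := by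
    rw [Real.fourier_eq', ← integral_window_mul_exp]
    congr 1 with s
    rw [smul_eq_mul, mul_comm, RCLike.inner_apply, conj_trivial]
    push_cast
    ring_nf
  have hfourier_int : Integrable (𝓕 fun s => (window s : ℂ)) :=
    (integrable_kernel.comp_mul_right' (by simp [Real.pi_ne_zero])).ofReal.congr
      (.of_forall fun v => (hfourier v).symm)
  have hinv := congrFun (hcont.fourierInv_fourier_eq hint hfourier_int) (-θ)
  have hrescale (v : ℝ) : exp (↑(2 * Real.pi * inner ℝ v (-θ)) * I) •
      𝓕 (fun s => (window s : ℂ)) v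
      = (fun y : ℝ => (kernel y : ℂ) * exp (θ * y * I)) (v * (-2 * Real.pi)) := by
    rw [smul_eq_mul, mul_comm, hfourier, RCLike.inner_apply, conj_trivial]
    push_cast
    ring_nf
  have hpi : |(-2 * Real.pi)⁻¹| = (2 * Real.pi)⁻¹ := by
    rw [abs_inv, abs_mul, abs_neg, abs_two, abs_of_pos Real.pi_pos]
  rw [Real.fourierInv_eq', integral_congr_ae (.of_forall hrescale),
    Measure.integral_comp_mul_right (fun y : ℝ => (kernel y : ℂ) * exp (θ * y * I)), hpi,
    window_neg, inv_smul_eq_iff₀ (by simp [Real.pi_ne_zero])] at hinv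
  rw [hinv, real_smul]
  push_cast
  rfl

/-- On every bounded set of frequencies, the characteristic function of `Q n` is that of a centred
normal variable of standard deviation `h n`, up to a factor `exp e` whose exponent `e` is negligible
compared with the Gaussian one, uniformly in the frequency. -/
def IsGaussianScaling (Q : ℕ → Measure ℝ) (h : ℕ → ℝ) : Prop :=
  ∀ A ε : ℝ, 0 < ε → ∀ᶠ n in atTop, ∀ s : ℝ, |s| ≤ A → ∃ e : ℂ, ‖e‖ ≤ ε * (h n * s) ^ 2 ∧
    charFun (Q n) s = Complex.exp (-(h n * s) ^ 2 / 2 + e)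

/-- The probability measure with density proportional to `kernel` with respect to `P`. -/
noncomputable def kernelMeasure (P : Measure ℝ) : Measure ℝ := P.tilted fun y => Real.log (kernel y)

section KernelMeasure

variable {P : Measure ℝ}

lemma isProbabilityMeasure_kernelMeasure [NeZero P] (hP : Integrable kernel P) :
    IsProbabilityMeasure (kernelMeasure P) :=
  isProbabilityMeasure_tilted (by simpa only [Real.exp_log (kernel_pos _)] using hP)

lemma integral_kernel_pos [NeZero P] (hP : Integrable kernel P) : 0 < ∫ y, kernel y ∂P := by
  simpa only [Real.exp_log (kernel_pos _)] using
    integral_exp_pos (f := fun y => Real.log (kernel y))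
      (by simpa only [Real.exp_log (kernel_pos _)] using hP)

lemma integral_kernelMeasure {E : Type*} [NormedAddCommGroup E] [NormedSpace ℝ E] (f : ℝ → E) :
    ∫ y, f y ∂kernelMeasure P = (∫ y, kernel y ∂P)⁻¹ • ∫ y, kernel y • f y ∂P := by
  simp only [kernelMeasure, integral_tilted, Real.exp_log (kernel_pos _), div_eq_inv_mul, mul_smul,
    integral_smul]

lemma integrable_kernel_of_isFiniteMeasure [IsFiniteMeasure P] : Integrable kernel P := by
  refine .of_bound continuous_kernel.aestronglyMeasurable (2 * (Real.cosh 1 + 1))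
    (.of_forall fun y => ?_)
  rw [Real.norm_of_nonneg (kernel_pos y).le]
  refine (kernel_le y).trans (mul_le_of_le_one_right ?_ (inv_le_one_of_one_le₀ ?_))
  · linarith [one_lt_cosh_one]
  · nlinarith

end KernelMeasure

lemma integral_fourier_eq_integral_charFun (P : Measure ℝ) [IsProbabilityMeasure P] {T : ℝ → ℂ}
    (hT : Integrable T) :
    ∫ y, (∫ s : ℝ, T s * Complex.exp (s * y * Complex.I)) ∂P = ∫ s, T s * charFun P s := by
  rw [integral_integral_swap]
  · congr 1 with s
    rw [integral_const_mul, charFun_apply_real]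
  · refine (hT.comp_snd P).mono
      (hT.aestronglyMeasurable.comp_snd.mul (by fun_prop)) (.of_forall fun z => ?_)
    have hphase : (z.2 * z.1 * Complex.I : ℂ) = ((z.2 * z.1 : ℝ) : ℂ) * Complex.I := by
      push_cast
      rfl
    rw [Function.uncurry_def, norm_mul, hphase, Complex.norm_exp_ofReal_mul_I, mul_one]

namespace IsGaussianScaling

variable {Q : ℕ → Measure ℝ} {h : ℕ → ℝ}

lemma tendsto_charFun_div (hQ : IsGaussianScaling Q h) (hh : Tendsto h atTop atTop) (t : ℝ) :
    Tendsto (fun n => charFun (Q n) (t / h n)) atTop (𝓝 (Complex.exp (-t ^ 2 / 2))) := by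
  have hexp : ContinuousAt (fun e : ℂ => Complex.exp (-t ^ 2 / 2 + e)) 0 := by fun_prop
  rw [Metric.continuousAt_iff] at hexp
  rw [Metric.tendsto_nhds]
  intro η hη
  obtain ⟨δ, hδ, hδη⟩ := hexp η hη
  filter_upwards [hQ |t| (δ / (t ^ 2 + 1)) (by positivity), hh.eventually_ge_atTop 1] with n hn h1
  have hpos : 0 < h n := one_pos.trans_le h1
  have hle : |t / h n| ≤ |t| := by
    rw [abs_div, abs_of_pos hpos]
    exact div_le_self (abs_nonneg t) h1
  obtain ⟨e, he, hchar⟩ := hn _ hle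
  have hcancel : (h n : ℂ) * (t / h n) = t := mul_div_cancel₀ _ (by exact_mod_cast hpos.ne')
  rw [mul_div_cancel₀ t hpos.ne'] at he
  push_cast at hchar
  rw [hchar, hcancel]
  simpa using hδη (x := e) (by
    rw [dist_zero_right]
    refine he.trans_lt ?_
    rw [div_mul_eq_mul_div, div_lt_iff₀ (by positivity)]
    linarith)

lemma eventually_norm_charFun_le (hQ : IsGaussianScaling Q h) (A : ℝ) :
    ∀ᶠ n in atTop, ∀ s : ℝ, |s| ≤ A → ‖charFun (Q n) s‖ ≤ Real.exp (-(1 / 4) * (h n * s) ^ 2) := by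
  filter_upwards [hQ A (1 / 4) (by norm_num)] with n hn s hs
  obtain ⟨e, he, hchar⟩ := hn s hs
  have hre : (-(h n * s : ℂ) ^ 2 / 2).re = -(h n * s) ^ 2 / 2 := by norm_cast
  rw [hchar, Complex.norm_exp, Complex.add_re, hre]
  gcongr
  linarith [Complex.re_le_norm e]

variable [∀ n, IsProbabilityMeasure (Q n)]

lemma tendsto_mul_integral_fourier (hQ : IsGaussianScaling Q h) (hh : Tendsto h atTop atTop)
    {T : ℝ → ℂ} (hT : Continuous T) (hsupp : HasCompactSupport T) :
    Tendsto (fun n => (h n : ℂ) * ∫ y, (∫ s : ℝ, T s * Complex.exp (s * y * Complex.I)) ∂(Q n))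
      atTop (𝓝 (√(2 * Real.pi) * T 0)) := by
  obtain ⟨A, -, hA⟩ := hsupp.exists_pos_le_norm
  obtain ⟨M, hM⟩ := hT.bounded_above_of_compact_support hsupp
  have hM0 : 0 ≤ M := (norm_nonneg _).trans (hM 0)
  have hrescale : ∀ᶠ n in atTop,
      ∫ t : ℝ, T (t / h n) * charFun (Q n) (t / h n)
        = (h n : ℂ) * ∫ y, (∫ s : ℝ, T s * Complex.exp (s * y * Complex.I)) ∂(Q n) := by
    filter_upwards [hh.eventually_gt_atTop 0] with n hn
    rw [integral_fourier_eq_integral_charFun _ (hT.integrable_of_hasCompactSupport hsupp),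
      Measure.integral_comp_div (fun s => T s * charFun (Q n) s), abs_of_pos hn, Complex.real_smul]
  have hgaussian : ∫ t : ℝ, T 0 * Complex.exp (-t ^ 2 / 2) = √(2 * Real.pi) * T 0 := by
    have hint : ∫ t : ℝ, Complex.exp (-t ^ 2 / 2) = √(2 * Real.pi) := by
      have hreal : ∫ t : ℝ, Real.exp (-(1 / 2) * t ^ 2) = √(2 * Real.pi) := by
        rw [integral_gaussian, div_div_eq_mul_div, div_one, mul_comm]
      rw [← hreal, ← integral_complex_ofReal]
      congr 1 with t
      push_cast
      ring_nf
    rw [integral_const_mul, hint, mul_comm]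
  rw [← hgaussian]
  refine (tendsto_integral_filter_of_dominated_convergence
    (fun t => M * Real.exp (-(1 / 4) * t ^ 2)) (.of_forall fun n => ?_) ?_
    ((integrable_exp_neg_mul_sq (by norm_num)).const_mul _)
    (.of_forall fun t => ?_)).congr' hrescale
  · have := measurable_charFun (μ := Q n)
    fun_prop
  · filter_upwards [hQ.eventually_norm_charFun_le A, hh.eventually_gt_atTop 0] with n hn hpos
    refine .of_forall fun t => ?_
    rcases le_total A ‖t / h n‖ with ht | ht
    · rw [hA _ ht, zero_mul, norm_zero]
      positivity
    · rw [norm_mul]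
      gcongr
      · exact hM _
      · simpa only [mul_div_cancel₀ t hpos.ne'] using hn _ ht
  · exact ((hT.tendsto 0).comp (hh.const_div_atTop t)).mul (hQ.tendsto_charFun_div hh t)

lemma tendsto_mul_integral_kernel_mul_exp (hQ : IsGaussianScaling Q h)
    (hh : Tendsto h atTop atTop) (θ : ℝ) :
    Tendsto (fun n => (h n : ℂ) * ∫ y, (kernel y : ℂ) * Complex.exp (θ * y * Complex.I) ∂(Q n))
      atTop (𝓝 ((√(2 * Real.pi) : ℂ)⁻¹ *
        ∫ y : ℝ, (kernel y : ℂ) * Complex.exp (θ * y * Complex.I))) := by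
  have hfourier (y : ℝ) : ∫ s : ℝ, (window (s - θ) : ℂ) * Complex.exp (s * y * Complex.I)
      = (kernel y : ℂ) * Complex.exp (θ * y * Complex.I) := by
    rw [← integral_add_right_eq_self _ θ, ← integral_window_mul_exp, ← integral_mul_const]
    congr 1 with s
    rw [add_sub_cancel_right, mul_assoc (window s : ℂ), ← Complex.exp_add]
    push_cast
    ring_nf
  have hsupp : HasCompactSupport fun s : ℝ => (window (s - θ) : ℂ) :=
    .intro (isCompact_closedBall θ 1) fun s hs => by
      rw [window_of_one_le (not_le.1 hs).le, Complex.ofReal_zero]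
  have hlim := hQ.tendsto_mul_integral_fourier hh (by fun_prop) hsupp
  simp only [hfourier, zero_sub, window_neg] at hlim
  have hsqrt : (√(2 * Real.pi) : ℂ) ^ 2 = 2 * Real.pi := by
    norm_cast
    exact Real.sq_sqrt (by positivity)
  have hsqrt0 : (√(2 * Real.pi) : ℂ) ≠ 0 := by
    norm_cast
    positivity
  convert hlim using 2
  rw [integral_kernel_mul_exp, ← hsqrt]
  field_simp

lemma tendsto_mul_integral_kernel (hQ : IsGaussianScaling Q h) (hh : Tendsto h atTop atTop) :
    Tendsto (fun n => h n * ∫ y, kernel y ∂(Q n)) atTop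
      (𝓝 ((√(2 * Real.pi))⁻¹ * ∫ y, kernel y)) := by
  have hlim := hQ.tendsto_mul_integral_kernel_mul_exp hh 0
  simp only [Complex.ofReal_zero, zero_mul, Complex.exp_zero, mul_one,
    integral_complex_ofReal] at hlim
  exact tendsto_ofReal_iff.1 (by exact_mod_cast hlim)

lemma tendsto_charFun_kernelMeasure (hQ : IsGaussianScaling Q h) (hh : Tendsto h atTop atTop)
    (θ : ℝ) : Tendsto (fun n => charFun (kernelMeasure (Q n)) θ) atTop
      (𝓝 (charFun (kernelMeasure volume) θ)) := by
  have hsqrt : (√(2 * Real.pi) : ℂ)⁻¹ ≠ 0 := by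
    norm_cast
    positivity
  have hkernel : ((∫ y, kernel y : ℝ) : ℂ) ≠ 0 := by
    exact_mod_cast (integral_kernel_pos integrable_kernel).ne'
  have hratio := (hQ.tendsto_mul_integral_kernel_mul_exp hh θ).div
    (tendsto_ofReal_iff.2 (hQ.tendsto_mul_integral_kernel hh))
    (by
      push_cast
      exact mul_ne_zero hsqrt hkernel)
  simp only [charFun_apply_real, integral_kernelMeasure, Complex.real_smul, Complex.ofReal_inv,
    inv_mul_eq_div]
  push_cast at hratio
  rw [mul_div_mul_left _ _ hsqrt] at hratio
  refine hratio.congr' ?_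
  filter_upwards [hh.eventually_gt_atTop 0] with n hn
  exact mul_div_mul_left _ _ (by exact_mod_cast hn.ne')

theorem tendsto_mul_integral (hQ : IsGaussianScaling Q h) (hh : Tendsto h atTop atTop) {f : ℝ → ℝ}
    (hf : Continuous f) {C : ℝ} (hC : ∀ y, |f y| ≤ C * (1 + y ^ 2)⁻¹) :
    Tendsto (fun n => h n * ∫ y, f y ∂(Q n)) atTop (𝓝 ((√(2 * Real.pi))⁻¹ * ∫ y, f y)) := by
  let P : ℕ → ProbabilityMeasure ℝ := fun n =>
    ⟨kernelMeasure (Q n), isProbabilityMeasure_kernelMeasure integrable_kernel_of_isFiniteMeasure⟩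
  let P₀ : ProbabilityMeasure ℝ :=
    ⟨kernelMeasure volume, isProbabilityMeasure_kernelMeasure integrable_kernel⟩
  have hP : Tendsto P atTop (𝓝 P₀) :=
    ProbabilityMeasure.tendsto_iff_tendsto_charFun.2 (hQ.tendsto_charFun_kernelMeasure hh)
  have hC0 : 0 ≤ C := by simpa using (abs_nonneg _).trans (hC 0)
  let g : BoundedContinuousFunction ℝ ℝ := .ofNormedAddCommGroup
    (fun y => f y / kernel y) (hf.div continuous_kernel fun y => (kernel_pos y).ne')
    (C * (2 * (Real.cosh 1 - 1))⁻¹) fun y => by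
      rw [norm_div, Real.norm_of_nonneg (kernel_pos y).le, div_le_iff₀ (kernel_pos y), mul_assoc]
      exact (hC y).trans (mul_le_mul_of_nonneg_left (inv_one_add_sq_le_kernel y) hC0)
  have hg (ν : Measure ℝ) :
      ∫ y, g y ∂kernelMeasure ν = (∫ y, kernel y ∂ν)⁻¹ * ∫ y, f y ∂ν := by
    simp only [g, integral_kernelMeasure, BoundedContinuousFunction.coe_ofNormedAddCommGroup,
      smul_eq_mul, mul_div_cancel₀ _ (kernel_pos _).ne']
  have hlim := (hQ.tendsto_mul_integral_kernel hh).mul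
    (ProbabilityMeasure.tendsto_iff_forall_integral_tendsto.1 hP g)
  simp only [P, P₀, ProbabilityMeasure.coe_mk, hg] at hlim
  rw [mul_assoc, mul_inv_cancel_left₀ (integral_kernel_pos integrable_kernel).ne'] at hlim
  refine hlim.congr fun n => ?_
  rw [mul_assoc,
    mul_inv_cancel_left₀ (integral_kernel_pos integrable_kernel_of_isFiniteMeasure).ne']

end IsGaussianScaling

/-- The integral of `exp (-y)` over `[t, ∞)`. -/
noncomputable def expTail (P : Measure ℝ) (t : ℝ) : ℝ := ∫ y in Set.Ici t, Real.exp (-y) ∂P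

/-- A continuous truncation of `y ↦ exp (-y)`, vanishing for `y ≤ t` and exact for
`t + δ ≤ y`; it is the test function squeezed between two tails. -/
noncomputable def expRamp (t δ y : ℝ) : ℝ := Real.exp (-y) * min 1 (max 0 ((y - t) / δ))

section Ramp

variable {P : Measure ℝ} {t δ y : ℝ}

@[fun_prop]
lemma continuous_expRamp : Continuous (expRamp t δ) := by
  unfold expRamp
  fun_prop

lemma expRamp_nonneg : 0 ≤ expRamp t δ y :=
  mul_nonneg (Real.exp_nonneg _) (le_min zero_le_one (le_max_left _ _))

lemma expRamp_le_indicator (hδ : 0 < δ) :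
    expRamp t δ y ≤ (Set.Ici t).indicator (fun y => Real.exp (-y)) y := by
  refine Set.le_indicator (fun y _ => ?_) (fun y hy => ?_) y
  · exact mul_le_of_le_one_right (Real.exp_nonneg _) (min_le_left _ _)
  · have hy : y < t := not_le.1 hy
    rw [expRamp, max_eq_left (div_nonpos_of_nonpos_of_nonneg (by linarith) hδ.le),
      min_eq_right zero_le_one, mul_zero]

lemma indicator_le_expRamp (hδ : 0 < δ) :
    (Set.Ici (t + δ)).indicator (fun y => Real.exp (-y)) y ≤ expRamp t δ y := by
  refine Set.indicator_le' (g := expRamp t δ) (fun y hy => ?_) (fun _ _ => expRamp_nonneg) y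
  have hy : 1 ≤ (y - t) / δ := by
    rw [le_div_iff₀ hδ]
    linarith [Set.mem_Ici.1 hy]
  rw [expRamp, min_eq_left (hy.trans (le_max_right _ _)), mul_one]

lemma exp_neg_le_inv_one_add_sq (hy : t ≤ y) :
    Real.exp (-y) ≤ 2 * Real.exp (2 * |t|) * (1 + y ^ 2)⁻¹ := by
  have hyt : |y| ≤ y + 2 * |t| := by
    rcases abs_cases y with h | h <;> rcases abs_cases t with h' | h' <;> linarith
  have hquad := Real.quadratic_le_exp_of_nonneg (abs_nonneg y)
  rw [sq_abs] at hquad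
  rw [le_mul_inv_iff₀ (by positivity)]
  calc Real.exp (-y) * (1 + y ^ 2)
      ≤ Real.exp (-y) * (2 * Real.exp |y|) := by
        gcongr
        linarith [abs_nonneg y]
    _ = 2 * Real.exp (|y| - y) := by
        rw [sub_eq_neg_add, Real.exp_add]
        ring
    _ ≤ 2 * Real.exp (2 * |t|) := by
        gcongr
        linarith

lemma abs_expRamp_le (hδ : 0 < δ) :
    |expRamp t δ y| ≤ 2 * Real.exp (2 * |t|) * (1 + y ^ 2)⁻¹ := by
  rw [abs_of_nonneg expRamp_nonneg]
  exact (expRamp_le_indicator hδ).trans <| Set.indicator_le'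
    (fun _ hy => exp_neg_le_inv_one_add_sq hy) (fun y _ => by positivity) y

lemma integrableOn_exp_neg_Ici [IsFiniteMeasure P] (t : ℝ) :
    IntegrableOn (fun y => Real.exp (-y)) (Set.Ici t) P := by
  refine Measure.integrableOn_of_bounded (M := Real.exp (-t)) (measure_ne_top _ _) (by fun_prop) ?_
  filter_upwards [ae_restrict_mem measurableSet_Ici] with y (hy : t ≤ y)
  rw [Real.norm_eq_abs, Real.abs_exp]
  gcongr

lemma antitone_expTail [IsFiniteMeasure P] : Antitone (expTail P) := fun s _ hst =>
  setIntegral_mono_set (integrableOn_exp_neg_Ici s) (.of_forall fun _ => Real.exp_nonneg _)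
    (Set.Ici_subset_Ici.2 hst).eventuallyLE

lemma integral_expRamp_le_expTail (hP : IntegrableOn (fun y => Real.exp (-y)) (Set.Ici t) P)
    (hδ : 0 < δ) : ∫ y, expRamp t δ y ∂P ≤ expTail P t := by
  rw [expTail, ← integral_indicator measurableSet_Ici]
  exact integral_mono_of_nonneg (.of_forall fun _ => expRamp_nonneg)
    (hP.integrable_indicator measurableSet_Ici) (.of_forall fun _ => expRamp_le_indicator hδ)

lemma expTail_add_le_integral_expRamp
    (hP : IntegrableOn (fun y => Real.exp (-y)) (Set.Ici t) P) (hδ : 0 < δ) :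
    expTail P (t + δ) ≤ ∫ y, expRamp t δ y ∂P := by
  rw [expTail, ← integral_indicator measurableSet_Ici]
  refine integral_mono_of_nonneg
    (.of_forall fun _ => Set.indicator_nonneg (fun _ _ => Real.exp_nonneg _) _)
    ((hP.integrable_indicator measurableSet_Ici).mono'
      continuous_expRamp.aestronglyMeasurable (.of_forall fun y => ?_))
    (.of_forall fun _ => indicator_le_expRamp hδ)
  rw [Real.norm_of_nonneg expRamp_nonneg]
  exact expRamp_le_indicator hδ

lemma expTail_volume (t : ℝ) : expTail volume t = Real.exp (-t) := by
  rw [expTail, integral_Ici_eq_integral_Ioi, integral_exp_neg_Ioi]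

end Ramp

lemma tendsto_of_antitone_of_interlacing {α : Type*} {l : Filter α} {F : α → ℝ → ℝ}
    {G : ℝ → ℝ → α → ℝ} {φ : ℝ → ℝ} {g : ℝ → ℝ → ℝ} {t : α → ℝ} {t₀ : ℝ}
    (hF : ∀ᶠ n in l, Antitone (F n)) (hGF : ∀ s δ, 0 < δ → ∀ᶠ n in l, G s δ n ≤ F n s)
    (hFG : ∀ s δ, 0 < δ → ∀ᶠ n in l, F n (s + δ) ≤ G s δ n) (hgφ : ∀ s δ, 0 < δ → g s δ ≤ φ s)
    (hφg : ∀ s δ, 0 < δ → φ (s + δ) ≤ g s δ)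
    (hG : ∀ s δ, 0 < δ → Tendsto (G s δ) l (𝓝 (g s δ))) (hφ : ContinuousAt φ t₀)
    (ht : Tendsto t l (𝓝 t₀)) : Tendsto (fun n => F n (t n)) l (𝓝 (φ t₀)) := by
  have hlim (k : ℝ) : Tendsto (fun δ => φ (t₀ + k * δ)) (𝓝[>] 0) (𝓝 (φ t₀)) :=
    hφ.tendsto.comp (((by fun_prop : Continuous fun δ => t₀ + k * δ).tendsto' 0 t₀
      (by simp)).mono_left nhdsWithin_le_nhds)
  refine tendsto_order.2 ⟨fun a ha => ?_, fun a ha => ?_⟩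
  · obtain ⟨δ, hδa, hδ : 0 < δ⟩ :=
      (((hlim 2).eventually_const_lt ha).and self_mem_nhdsWithin).exists
    rw [two_mul, ← add_assoc] at hδa
    filter_upwards [(hG _ δ hδ).eventually_const_lt (hδa.trans_le (hφg _ δ hδ)),
      ht.eventually_lt_const (lt_add_of_pos_right t₀ hδ), hF, hGF _ δ hδ] with n hn htn hFn hle
    exact hn.trans_le (hle.trans (hFn htn.le))
  · obtain ⟨δ, hδa, hδ : 0 < δ⟩ :=
      (((hlim (-2)).eventually_lt_const ha).and self_mem_nhdsWithin).exists
    filter_upwards [(hG _ δ hδ).eventually_lt_const ((hgφ _ δ hδ).trans_lt hδa),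
      ht.eventually_const_lt (sub_lt_self t₀ hδ), hF, hFG _ δ hδ] with n hn htn hFn hle
    refine ((hFn ?_).trans hle).trans_lt hn
    linarith

theorem IsGaussianScaling.tendsto_mul_expTail {Q : ℕ → Measure ℝ}
    [∀ n, IsProbabilityMeasure (Q n)] {h t : ℕ → ℝ} {t₀ : ℝ} (hQ : IsGaussianScaling Q h)
    (hh : Tendsto h atTop atTop) (ht : Tendsto t atTop (𝓝 t₀)) :
    Tendsto (fun n => h n * expTail (Q n) (t n)) atTop
      (𝓝 ((√(2 * Real.pi))⁻¹ * Real.exp (-t₀))) := by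
  have hpos : ∀ᶠ n in atTop, 0 ≤ h n := hh.eventually_ge_atTop 0
  have hvol (s : ℝ) : IntegrableOn (fun y => Real.exp (-y)) (Set.Ici s) :=
    integrableOn_Ici_iff_integrableOn_Ioi (by simp) |>.2 (integrableOn_exp_neg_Ioi s)
  refine tendsto_of_antitone_of_interlacing (F := fun n s => h n * expTail (Q n) s)
    (φ := fun s => (√(2 * Real.pi))⁻¹ * Real.exp (-s)) ?_ ?_ ?_ ?_ ?_
    (fun s δ hδ => hQ.tendsto_mul_integral hh (f := expRamp s δ) continuous_expRamp
      fun _ => abs_expRamp_le hδ)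
    (by fun_prop) ht
  · filter_upwards [hpos] with n hn
    exact antitone_expTail.const_mul hn
  · intro s δ hδ
    filter_upwards [hpos] with n hn
    exact mul_le_mul_of_nonneg_left
      (integral_expRamp_le_expTail (integrableOn_exp_neg_Ici s) hδ) hn
  · intro s δ hδ
    filter_upwards [hpos] with n hn
    exact mul_le_mul_of_nonneg_left
      (expTail_add_le_integral_expRamp (integrableOn_exp_neg_Ici s) hδ) hn
  · intro s δ hδ
    rw [← expTail_volume]
    gcongr
    exact integral_expRamp_le_expTail (hvol s) hδ
  · intro s δ hδ
    rw [← expTail_volume]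
    gcongr
    exact expTail_add_le_integral_expRamp (hvol s) hδ

section Tilt

variable {Ω : Type*} [MeasurableSpace Ω] {W : Ω → ℝ} {μ : Measure Ω} {h x : ℝ}

/-- The law of `h (W - x)` under the Esscher transform of `μ`, i.e. the measure with density
proportional to `exp (h W)`. -/
noncomputable def tiltedLaw (W : Ω → ℝ) (μ : Measure Ω) (h x : ℝ) : Measure ℝ :=
  (μ.tilted fun ω => h * W ω).map fun ω => h * (W ω - x)

lemma aemeasurable_mul_sub_tilted (hW : AEMeasurable W μ) :
    AEMeasurable (fun ω => h * (W ω - x)) (μ.tilted fun ω => h * W ω) :=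
  AEMeasurable.mono_ac (by fun_prop) (tilted_absolutelyContinuous μ _)

lemma isProbabilityMeasure_tiltedLaw [NeZero μ] (hW : AEMeasurable W μ)
    (hh : h ∈ integrableExpSet W μ) : IsProbabilityMeasure (tiltedLaw W μ h x) :=
  have := isProbabilityMeasure_tilted (μ := μ) (f := fun ω => h * W ω) hh
  Measure.isProbabilityMeasure_map (aemeasurable_mul_sub_tilted hW)

lemma charFun_tiltedLaw (hW : AEMeasurable W μ) (h x s : ℝ) :
    charFun (tiltedLaw W μ h x) s = complexMGF W μ (h + h * s * Complex.I) / mgf W μ h *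
      Complex.exp (-(h * s * Complex.I * x)) := by
  rw [charFun_apply_real, tiltedLaw, integral_map (aemeasurable_mul_sub_tilted hW) (by fun_prop),
    integral_tilted, complexMGF, ← integral_div, ← integral_mul_const]
  congr 1 with ω
  rw [Complex.real_smul, mgf]
  push_cast
  rw [div_mul_eq_mul_div, div_mul_eq_mul_div, ← Complex.exp_add, ← Complex.exp_add]
  ring_nf

lemma expTail_tiltedLaw (hW : AEMeasurable W μ) (hh : 0 < h) (x b : ℝ) :
    expTail (tiltedLaw W μ h x) (h * b)
      = Real.exp (h * x) / mgf W μ h * μ.real {ω | x + b ≤ W ω} := by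
  have hset : NullMeasurableSet {ω | x + b ≤ W ω} μ := nullMeasurableSet_le aemeasurable_const hW
  rw [expTail, tiltedLaw, ← integral_indicator measurableSet_Ici,
    integral_map (aemeasurable_mul_sub_tilted hW)
      (Measurable.indicator (by fun_prop) measurableSet_Ici).aestronglyMeasurable,
    integral_tilted, ← setIntegral_one_eq_measureReal, ← integral_indicator₀ hset,
    ← integral_const_mul]
  congr 1 with ω
  have hmem : h * (W ω - x) ∈ Set.Ici (h * b) ↔ ω ∈ {ω | x + b ≤ W ω} := by
    rw [Set.mem_Ici, mul_le_mul_iff_right₀ hh, le_sub_iff_add_le', Set.mem_ofPred_eq]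
  by_cases hω : ω ∈ {ω | x + b ≤ W ω}
  · rw [Set.indicator_of_mem (hmem.2 hω), Set.indicator_of_mem hω, smul_eq_mul,
      mul_one, div_mul_eq_mul_div, ← Real.exp_add, mgf]
    ring_nf
  · rw [Set.indicator_of_notMem (mt hmem.1 hω), Set.indicator_of_notMem hω, smul_zero, mul_zero]

end Tilt

namespace IsCGFOnDisc

variable {Ω : Type*} [MeasurableSpace Ω] {W : Ω → ℝ} {μ : Measure Ω} {h x D C ρ s : ℝ} {L : ℂ → ℂ}

lemma charFun_tiltedLaw (hL : IsCGFOnDisc W μ D L) (h0 : |h| < D)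
    (hs : ‖(h + h * s * Complex.I : ℂ)‖ < D) :
    charFun (tiltedLaw W μ h x) s
      = Complex.exp (L (h + h * s * Complex.I) - L h - h * s * Complex.I * x) := by
  have hD : 0 < D := (abs_nonneg h).trans_lt h0
  rw [CramerField.charFun_tiltedLaw (hL.aemeasurable hD), ← complexMGF_ofReal, ← hL.exp_eq _ hs,
    ← hL.exp_eq h (by simpa using h0), ← Complex.exp_sub, ← Complex.exp_add, ← sub_eq_add_neg]

lemma differentiableOn_sub_sq (hL : IsCGFOnDisc W μ D L) :
    DifferentiableOn ℂ (fun z => L z - z ^ 2 / 2) (Metric.ball 0 D) :=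
  hL.differentiableOn.sub (by fun_prop)

lemma deriv_sub_sq_ofReal (hL : IsCGFOnDisc W μ D L) (hh : |h| < D) :
    deriv (fun z => L z - z ^ 2 / 2) (h : ℂ) = ((deriv (cgf W μ) h - h : ℝ) : ℂ) := by
  have hh' : (h : ℂ) ∈ Metric.ball 0 D := by simpa using hh
  have hLd : DifferentiableAt ℂ L h := (hL.analytic _ hh').differentiableAt
  rw [deriv_fun_sub hLd (by fun_prop), hL.deriv_ofReal hh]
  simp

lemma exists_charFun_tiltedLaw_eq (hL : IsCGFOnDisc W μ D L)
    (hC : ∀ z : ℂ, ‖z‖ < D → ‖L z - z ^ 2 / 2‖ ≤ C * ‖z‖ ^ 3) (hsaddle : deriv (cgf W μ) h = x)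
    (hρ : 0 < ρ) (hρD : 3 * ρ < D) (hh : |h| ≤ ρ) (hhs : |h * s| ≤ ρ) :
    ∃ e : ℂ, ‖e‖ ≤ 27 / 2 * C * ρ * (h * s) ^ 2 ∧
      charFun (tiltedLaw W μ h x) s = Complex.exp (-(h * s) ^ 2 / 2 + e) := by
  have hhD : |h| < D := by linarith
  have hh' : ‖(h : ℂ)‖ ≤ ρ := by simpa using hh
  have hw : ‖(h * s * Complex.I : ℂ)‖ = |h * s| := by simp [abs_mul]
  have hhw : ‖(h + h * s * Complex.I : ℂ)‖ < D := by
    linarith [norm_add_le (h : ℂ) (h * s * Complex.I)]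
  have hbound := norm_add_sub_sub_smul_deriv_le_of_norm_le_pow hL.differentiableOn_sub_sq hC
    hρ hρD hh' (hw.trans_le hhs)
  refine ⟨_, hbound.trans_eq ?_, ?_⟩
  · rw [hw, div_pow, sq_abs]
    field_simp
    ring
  · rw [hL.charFun_tiltedLaw hhD hhw, hL.deriv_sub_sq_ofReal hhD, hsaddle, smul_eq_mul]
    congr 1
    push_cast
    linear_combination ((h * s) ^ 2 / 2 : ℂ) * Complex.I_sq

/-- The intermediate value theorem for `deriv (cgf W μ)`, which differs from the identity by
`O(x²)`. -/
lemma exists_saddlePoint (hL : IsCGFOnDisc W μ D L)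
    (hC : ∀ z : ℂ, ‖z‖ < D → ‖L z - z ^ 2 / 2‖ ≤ C * ‖z‖ ^ 3) (hx : 0 < x) (hxD : 4 * x < D)
    (hCx : 64 * C * x ≤ 1) : ∃ h, |h| < D ∧ deriv (cgf W μ) h = x ∧ |h - x| ≤ 32 * C * x ^ 2 := by
  have habs : ∀ u ∈ Set.Icc (x / 2) (2 * x), |u| ≤ 2 * x := fun u hu =>
    abs_le.2 ⟨by linarith [hu.1], hu.2⟩
  have hbound : ∀ u ∈ Set.Icc (x / 2) (2 * x), |deriv (cgf W μ) u - u| ≤ 32 * C * x ^ 2 := by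
    intro u hu
    have := norm_deriv_le_of_norm_le_pow hL.differentiableOn_sub_sq hC
      (ρ := 2 * x) (z := u) (by positivity) (by linarith) (by simpa using habs u hu)
    rw [hL.deriv_sub_sq_ofReal ((habs u hu).trans_lt (by linarith)), Complex.norm_real,
      Real.norm_eq_abs] at this
    refine this.trans_eq ?_
    field_simp
    ring
  have hhalf : 32 * C * x ^ 2 ≤ x / 2 := by nlinarith
  have hcont : ContinuousOn (deriv (cgf W μ)) (Set.Icc (x / 2) (2 * x)) := fun u hu =>
    (analyticAt_cgf (hL.mem_interior_integrableExpSet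
      ((habs u hu).trans_lt (by linarith)))).deriv.continuousAt.continuousWithinAt
  have hl := abs_le.1 (hbound (x / 2) ⟨le_rfl, by linarith⟩)
  have hr := abs_le.1 (hbound (2 * x) ⟨by linarith, le_rfl⟩)
  obtain ⟨h, hh, hsaddle⟩ := intermediate_value_Icc (by linarith) hcont
    (show x ∈ Set.Icc _ _ from ⟨by linarith, by linarith⟩)
  refine ⟨h, (habs h hh).trans_lt (by linarith), hsaddle, ?_⟩
  simpa only [hsaddle, abs_sub_comm] using hbound h hh

end IsCGFOnDisc

section RatioLimit

variable {Ω : ℕ → Type*} [∀ n, MeasurableSpace (Ω n)] {μ : ∀ n, Measure (Ω n)}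
  {W : ∀ n, Ω n → ℝ} {L : ℕ → ℂ → ℂ} {C D h x : ℕ → ℝ}

lemma isGaussianScaling_tiltedLaw (hL : ∀ n, IsCGFOnDisc (W n) (μ n) (D n) (L n))
    (hC : ∀ᶠ n in atTop, ∀ z : ℂ, ‖z‖ < D n → ‖L n z - z ^ 2 / 2‖ ≤ C n * ‖z‖ ^ 3)
    (hCx : Tendsto (fun n => C n * x n) atTop (𝓝 0))
    (hDx : Tendsto (fun n => D n / x n) atTop atTop) (hx : ∀ᶠ n in atTop, 0 < x n)
    (hsaddle : ∀ᶠ n in atTop, deriv (cgf (W n) (μ n)) (h n) = x n)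
    (hhx : Tendsto (fun n => h n / x n) atTop (𝓝 1)) :
    IsGaussianScaling (fun n => tiltedLaw (W n) (μ n) (h n) (x n)) h := by
  intro A ε hε
  filter_upwards [hC, hx, hsaddle, hDx.eventually_gt_atTop (6 * (|A| + 1)),
    hCx.eventually_le_const (show 0 < ε / (27 * (|A| + 1)) by positivity),
    hhx.abs.eventually_le_const (show |(1 : ℝ)| < 2 by norm_num)]
    with n hCn hxn hsn hDn hCxn hhn s hs
  rw [lt_div_iff₀ hxn] at hDn
  rw [le_div_iff₀ (by positivity)] at hCxn
  rw [abs_div, abs_of_pos hxn, div_le_iff₀ hxn] at hhn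
  have hhs : |h n * s| ≤ 2 * x n * (|A| + 1) := by
    rw [abs_mul]
    gcongr
    linarith [le_abs_self A]
  obtain ⟨e, he, hchar⟩ := (hL n).exists_charFun_tiltedLaw_eq (ρ := 2 * x n * (|A| + 1)) hCn hsn
    (by positivity) (by linarith) (by nlinarith [abs_nonneg A]) hhs
  exact ⟨e, he.trans (mul_le_mul_of_nonneg_right (by linarith) (sq_nonneg _)), hchar⟩

variable [∀ n, IsProbabilityMeasure (μ n)]

lemma exists_seq_saddlePoint (hL : ∀ n, IsCGFOnDisc (W n) (μ n) (D n) (L n))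
    (hC : ∀ᶠ n in atTop, ∀ z : ℂ, ‖z‖ < D n → ‖L n z - z ^ 2 / 2‖ ≤ C n * ‖z‖ ^ 3)
    (hCx : Tendsto (fun n => C n * x n) atTop (𝓝 0))
    (hDx : Tendsto (fun n => D n / x n) atTop atTop) (hx : ∀ᶠ n in atTop, 0 < x n) :
    ∃ h : ℕ → ℝ, (∀ n, h n ∈ integrableExpSet (W n) (μ n)) ∧
      (∀ᶠ n in atTop, deriv (cgf (W n) (μ n)) (h n) = x n) ∧
      Tendsto (fun n => h n / x n) atTop (𝓝 1) := by
  have hsaddle : ∀ᶠ n in atTop, ∃ h, |h| < D n ∧ deriv (cgf (W n) (μ n)) h = x n ∧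
      |h - x n| ≤ 32 * C n * x n ^ 2 := by
    filter_upwards [hC, hx, hDx.eventually_gt_atTop 4,
      hCx.eventually_le_const (show (0 : ℝ) < 1 / 64 by norm_num)] with n hCn hxn hDn hCxn
    exact (hL n).exists_saddlePoint hCn hxn ((lt_div_iff₀ hxn).1 hDn) (by linarith)
  have hchoice (n : ℕ) : ∃ h ∈ integrableExpSet (W n) (μ n),
      (∃ h, |h| < D n ∧ deriv (cgf (W n) (μ n)) h = x n ∧ |h - x n| ≤ 32 * C n * x n ^ 2) →
        deriv (cgf (W n) (μ n)) h = x n ∧ |h - x n| ≤ 32 * C n * x n ^ 2 := by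
    by_cases hn : ∃ h, |h| < D n ∧ deriv (cgf (W n) (μ n)) h = x n ∧ |h - x n| ≤ 32 * C n * x n ^ 2
    · obtain ⟨h, hhD, hh⟩ := hn
      exact ⟨h, (hL n).mem_integrableExpSet hhD, fun _ => hh⟩
    · exact ⟨0, by simp [integrableExpSet], fun h => absurd h hn⟩
  choose h hmem hh using hchoice
  refine ⟨h, hmem, hsaddle.mono fun n hn => (hh n hn).1, ?_⟩
  rw [tendsto_iff_norm_sub_tendsto_zero]
  refine squeeze_zero' (.of_forall fun _ => norm_nonneg _) ?_ (by simpa using hCx.const_mul 32)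
  filter_upwards [hsaddle, hx] with n hn hxn
  rw [div_sub_one hxn.ne', norm_div, Real.norm_eq_abs, Real.norm_of_nonneg hxn.le,
    div_le_iff₀ hxn]
  exact (hh n hn).2.trans_eq (by ring)

theorem tendsto_measureReal_div_measureReal (hL : ∀ n, IsCGFOnDisc (W n) (μ n) (D n) (L n))
    (hW : ∀ n, AEMeasurable (W n) (μ n))
    (hC : ∀ᶠ n in atTop, ∀ z : ℂ, ‖z‖ < D n → ‖L n z - z ^ 2 / 2‖ ≤ C n * ‖z‖ ^ 3)
    (hCx : Tendsto (fun n => C n * x n) atTop (𝓝 0))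
    (hDx : Tendsto (fun n => D n / x n) atTop atTop) (hx : Tendsto x atTop atTop) (a : ℝ) :
    Tendsto (fun n => (μ n).real {ω | x n + a / x n ≤ W n ω} / (μ n).real {ω | x n ≤ W n ω})
      atTop (𝓝 (Real.exp (-a))) := by
  have hx0 : ∀ᶠ n in atTop, 0 < x n := hx.eventually_gt_atTop 0
  obtain ⟨h, hmem, hsaddle, hhx⟩ := exists_seq_saddlePoint hL hC hCx hDx hx0
  have hh : Tendsto h atTop atTop := by
    refine (hhx.pos_mul_atTop one_pos hx).congr' ?_
    filter_upwards [hx0] with n hn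
    exact div_mul_cancel₀ _ hn.ne'
  have := fun n => isProbabilityMeasure_tiltedLaw (x := x n) (hW n) (hmem n)
  have hQ := isGaussianScaling_tiltedLaw hL hC hCx hDx hx0 hsaddle hhx
  have hha : Tendsto (fun n => h n * (a / x n)) atTop (𝓝 a) := by
    simpa only [one_mul, div_mul_eq_mul_div, mul_div_assoc] using hhx.mul_const a
  have hratio := (hQ.tendsto_mul_expTail hh hha).div (hQ.tendsto_mul_expTail hh
    (tendsto_const_nhds (x := 0))) (by positivity)
  rw [neg_zero, Real.exp_zero, mul_one, mul_div_cancel_left₀ _ (by positivity)] at hratio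
  refine hratio.congr' ?_
  filter_upwards [hh.eventually_gt_atTop 0] with n hn
  have hfactor : 0 < Real.exp (h n * x n) / mgf (W n) (μ n) (h n) :=
    div_pos (Real.exp_pos _) (mgf_pos (hmem n))
  have htail₀ := expTail_tiltedLaw (hW n) hn (x n) 0
  rw [mul_zero, add_zero] at htail₀
  rw [Pi.div_apply, mul_div_mul_left _ _ hn.ne', expTail_tiltedLaw (hW n) hn, htail₀,
    mul_div_mul_left _ _ hfactor.ne']

end RatioLimit

section Normalization

variable {Ω : Type*} [MeasurableSpace Ω] {μ : Measure Ω} {T : Ω → ℝ} {b x y : ℝ}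

lemma normCDF_eq_one_sub [IsProbabilityMeasure μ] (hT : AEMeasurable T μ) (hb : 0 < b) :
    normCDF T μ b x = 1 - μ.real {ω | x ≤ T ω / √b} := by
  rw [normCDF, ← probReal_compl_eq_one_sub₀
    (nullMeasurableSet_le aemeasurable_const (hT.div_const _))]
  congr 1 with ω
  rw [Set.mem_compl_iff, Set.mem_ofPred_eq, Set.mem_ofPred_eq, not_le,
    div_lt_iff₀ (Real.sqrt_pos.2 hb)]

lemma normCDF_sub_div_one_sub_normCDF [IsProbabilityMeasure μ] (hT : AEMeasurable T μ) (hb : 0 < b)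
    (hx : μ.real {ω | x ≤ T ω / √b} ≠ 0) :
    (normCDF T μ b y - normCDF T μ b x) / (1 - normCDF T μ b x)
      = 1 - μ.real {ω | y ≤ T ω / √b} / μ.real {ω | x ≤ T ω / √b} := by
  rw [normCDF_eq_one_sub hT hb, normCDF_eq_one_sub hT hb, sub_sub_cancel, sub_sub_sub_cancel_left,
    sub_div, div_self hx]

lemma norm_tsum_sub_sq_le {ι : Type*} {Y : ι → Ω → ℝ} {L : ι → ℂ → ℂ} {c : ι → ℝ} {r : ℝ} {z : ℂ}
    [IsProbabilityMeasure μ] (hr : 0 < r) (hb : 0 < b) (hL : ∀ j, IsCGFOnDisc (Y j) μ r (L j))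
    (hmean : ∀ j, μ[Y j] = 0) (hLc : ∀ j, ∀ z : ℂ, ‖z‖ < r → ‖L j z‖ ≤ c j) (hc : Summable c)
    (hvar : HasSum (fun j => Var[Y j; μ]) b) (hz : ‖z‖ ≤ r * √b / 2) :
    ‖∑' j, L j (z / √b) - z ^ 2 / 2‖ ≤ 2 * (∑' j, c j) / (r * √b) ^ 3 * ‖z‖ ^ 3 := by
  have hb' : 0 < √b := Real.sqrt_pos.2 hb
  have hnorm : ‖z / √b‖ = ‖z‖ / √b := by
    rw [norm_div, Complex.norm_real, Real.norm_of_nonneg hb'.le]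
  have hw : ‖z / √b‖ ≤ r / 2 := by
    rw [hnorm, div_le_iff₀ hb']
    linarith
  have hsq : (b : ℂ) * (z / √b) ^ 2 = z ^ 2 := by
    rw [div_pow, ← Complex.ofReal_pow, Real.sq_sqrt hb.le,
      mul_div_cancel₀ _ (Complex.ofReal_ne_zero.2 hb.ne')]
  have hsum : HasSum (fun j => L j (z / √b) - Var[Y j; μ] * (z / √b) ^ 2 / 2)
      (∑' j, L j (z / √b) - z ^ 2 / 2) := by
    rw [← hsq]
    exact (hc.of_norm_bounded fun j => hLc j _ (by linarith)).hasSum.sub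
      (((Complex.hasSum_ofReal.2 hvar).mul_right _).div_const 2)
  refine (hsum.norm_le_of_bounded ((hc.hasSum.mul_left 2).mul_right _) fun j =>
    (hL j).norm_sub_variance_mul_le hr (hmean j) (hLc j) hw).trans_eq ?_
  rw [hnorm]
  field_simp

lemma tendsto_cubicCoeff_mul {B H σ x : ℕ → ℝ} (hB : ∀ᶠ n in atTop, 0 < B n)
    (hσ : σ =O[atTop] fun n => B n * H n ^ 2) (hx : x =o[atTop] fun n => H n * √(B n)) :
    Tendsto (fun n => 2 * σ n / (H n * √(B n)) ^ 3 * x n) atTop (𝓝 0) := by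
  have hlim := (hσ.mul_isLittleO hx).tendsto_div_nhds_zero.const_mul 2
  rw [mul_zero] at hlim
  refine hlim.congr' ?_
  filter_upwards [hB] with n hn
  have hcube : (H n * √(B n)) ^ 3 = B n * H n ^ 2 * (H n * √(B n)) := by
    linear_combination H n ^ 3 * √(B n) * Real.sq_sqrt hn.le
  rw [hcube]
  ring

lemma tendsto_half_div_atTop {D x : ℕ → ℝ} (hD : ∀ᶠ n in atTop, 0 < D n)
    (hx : ∀ᶠ n in atTop, 0 < x n) (hxD : x =o[atTop] D) :
    Tendsto (fun n => D n / 2 / x n) atTop atTop := by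
  have hpos : ∀ᶠ n in atTop, x n / D n ∈ Set.Ioi 0 := by
    filter_upwards [hD, hx] with n hDn hxn using div_pos hxn hDn
  have hinv := (tendsto_nhdsWithin_iff.2 ⟨hxD.tendsto_div_nhds_zero, hpos⟩).inv_tendsto_nhdsGT_zero
  refine (hinv.atTop_div_const two_pos).congr fun n => ?_
  rw [Pi.inv_apply, inv_div, div_right_comm]

lemma tendsto_cube (d : ℕ) : Tendsto (cube d) atTop atTop := by
  refine tendsto_atTop_finset_of_monotone (fun m n hmn => ?_) fun j => ?_
  · exact Finset.Icc_subset_Icc (fun i => by simpa using hmn) fun i => by simpa using hmn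
  · have hj (i : Fin d) : |j i| ≤ ((∑ i, (j i).natAbs : ℕ) : ℤ) := by
      rw [← Int.natCast_natAbs]
      exact_mod_cast Finset.single_le_sum (f := fun i => (j i).natAbs)
        (fun _ _ => Nat.zero_le _) (Finset.mem_univ i)
    exact ⟨∑ i, (j i).natAbs, Finset.mem_Icc.2
      ⟨fun i => (abs_le.1 (hj i)).1, fun i => (abs_le.1 (hj i)).2⟩⟩

end Normalization

end CramerField

open CramerField in
theorem mainTheorem6_general {Ω ι : ℕ → Type*} [∀ n, MeasurableSpace (Ω n)]
    (μ : ∀ n, Measure (Ω n)) (X : ∀ n, ι n → Ω n → ℝ) (S : ∀ n, Ω n → ℝ)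
    (hmean : ∀ n j, (μ n)[X n j] = 0) (hindep : ∀ n, iIndepFun (X n) (μ n))
    (s : ∀ n, ℕ → Finset (ι n)) (hs : ∀ n, Tendsto (s n) atTop atTop)
    (hS : ∀ n, TendstoInMeasure (μ n) (fun m ω => ∑ j ∈ s n m, X n j ω) atTop (S n))
    (B : ℕ → ℝ) (hB : ∀ n, HasSum (fun j => Var[X n j; μ n]) (B n))
    (H : ℕ → ℝ) (hH : ∀ n, 0 < H n) (L : ∀ n, ι n → ℂ → ℂ)
    (hL : ∀ n j, IsCGFOnDisc (X n j) (μ n) (H n) (L n j)) (c : ∀ n, ι n → ℝ)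
    (hLc : ∀ n j, ∀ z : ℂ, ‖z‖ < H n → ‖L n j z‖ ≤ c n j)
    (hBH : Tendsto (fun n => B n * H n ^ 2) atTop atTop) (hc : ∀ n, Summable (c n))
    (hC : (fun n => ∑' j, c n j) =O[atTop] fun n => B n * H n ^ 2)
    (x : ℕ → ℝ) (hx : Tendsto x atTop atTop) (hxo : x =o[atTop] fun n => H n * √(B n)) (a : ℝ) :
    Tendsto (fun n =>
      (normCDF (S n) (μ n) (B n) (x n + a / x n) - normCDF (S n) (μ n) (B n) (x n))
        / (1 - normCDF (S n) (μ n) (B n) (x n))) atTop (𝓝 (1 - Real.exp (-a))) := by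
  have := fun n => (hindep n).isProbabilityMeasure
  have hSL (n : ℕ) := IsCGFOnDisc.tsum (hH n) (hL n) (hindep n) (hLc n) (hc n) (hs n) (hS n)
  have hSm (n : ℕ) : AEMeasurable (S n) (μ n) := (hSL n).aemeasurable (hH n)
  have hBpos : ∀ᶠ n in atTop, 0 < B n :=
    (hBH.eventually_gt_atTop 0).mono fun n hn => pos_of_mul_pos_left hn (sq_nonneg _)
  have hWL (n : ℕ) := ((hSL n).div_const (Real.sqrt_nonneg (B n))).mono
    (half_le_self (mul_nonneg (hH n).le (Real.sqrt_nonneg _)))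
  have hcubic : ∀ᶠ n in atTop, ∀ z : ℂ, ‖z‖ < H n * √(B n) / 2 →
      ‖∑' j, L n j (z / √(B n)) - z ^ 2 / 2‖
        ≤ 2 * (∑' j, c n j) / (H n * √(B n)) ^ 3 * ‖z‖ ^ 3 :=
    hBpos.mono fun n hn z hz =>
      norm_tsum_sub_sq_le (hH n) hn (hL n) (hmean n) (hLc n) (hc n) (hB n) hz.le
  have hratio := tendsto_measureReal_div_measureReal hWL (fun n => (hSm n).div_const _) hcubic
    (tendsto_cubicCoeff_mul hBpos hC hxo) (tendsto_half_div_atTop (hBpos.mono fun n hn =>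
      mul_pos (hH n) (Real.sqrt_pos.2 hn)) (hx.eventually_gt_atTop 0) hxo) hx a
  refine (hratio.const_sub 1).congr' ?_
  filter_upwards [hBpos, hratio.eventually_ne (Real.exp_ne_zero _)] with n hBn hn
  exact (normCDF_sub_div_one_sub_normCDF (hSm n) hBn (div_ne_zero_iff.1 hn).2).symm

theorem mainTheorem6 {Ω : Type*} [MeasurableSpace Ω] (μ : Measure Ω) [IsProbabilityMeasure μ]
    (d : ℕ)
    -- the random field and its sums
    (X : ℕ → (Fin d → ℤ) → Ω → ℝ) (S : ℕ → Ω → ℝ)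
    (hX_meas : ∀ n j, Measurable (X n j))
    (hX_mean : ∀ n j, μ[X n j] = 0)
    (hX_indep : ∀ n, iIndepFun (X n) μ)
    (hS : ∀ n, CramerField.IsFieldSum (X n) μ (S n))
    (hB : ∀ n, Summable (fun j => Var[X n j; μ]))
    -- Cramér's condition on the disc of radius `H n`
    (H : ℕ → ℝ) (hH : ∀ n, 0 < H n)
    (L : ℕ → (Fin d → ℤ) → ℂ → ℂ)
    (hL : ∀ n j, CramerField.IsCGFOnDisc (X n j) μ (H n) (L n j))
    -- the bounds `c n j` on the cumulant generating functions
    (c : ℕ → (Fin d → ℤ) → ℝ) (hc_nonneg : ∀ n j, 0 ≤ c n j)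
    (hLc : ∀ n j, ∀ z : ℂ, ‖z‖ < H n → ‖L n j z‖ ≤ c n j)
    (hBH : Tendsto (fun n => CramerField.totalVar (X n) μ * H n ^ 2) atTop atTop)
    (hc_summable : ∀ n, Summable (c n))
    (hC : (fun n => ∑' j, c n j) =O[atTop] fun n => CramerField.totalVar (X n) μ * H n ^ 2)
    -- the points `x n`
    (x : ℕ → ℝ) (hx : Tendsto x atTop atTop)
    (hxo : x =o[atTop] fun n => H n * √(CramerField.totalVar (X n) μ))
    (a : ℝ) (ha : 0 < a) :
    Tendsto
      (fun n =>
        (CramerField.normCDF (S n) μ (CramerField.totalVar (X n) μ) (x n + a / x n)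
            - CramerField.normCDF (S n) μ (CramerField.totalVar (X n) μ) (x n))
          / (1 - CramerField.normCDF (S n) μ (CramerField.totalVar (X n) μ) (x n)))
      atTop (𝓝 (1 - Real.exp (-a))) :=
  mainTheorem6_general (fun _ => μ) X S hX_mean hX_indep (fun _ => CramerField.cube d)
    (fun _ => CramerField.tendsto_cube d) hS _ (fun n => (hB n).hasSum) H hH L hL c hLc hBH
    hc_summable hC x hx hxo a
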